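/- Lemma 1 (Frequency Domain Bias of the Naive Estimator). Fix $T>0$. Let $B$ be a standard Brownian motion relative to a filtration, and let $dX_t=\mu_t\,dt+\sigma_t\,dB_t$ be an Itô process on $[0,T]$ with progressively measurable $\mu,\sigma$ satisfying $\mathrm E\int_0^T\mu_t^2\,dt<\infty$ and $\mathrm E\int_0^T\sigma_t^2\,dt<\infty$. For each $N\ge 1$ put $\Delta t=T/N$, $t_j=(j-1)\Delta t$ and $f_k=k/T$, and observe $Y_{t_j}=X_{t_j}+\varepsilon_{t_j}$, $j=1,\dots,N+1$, where $(\varepsilon_{t_j})_j$ is white noise (centred, pairwise uncorrelated, with variance $\sigma_\varepsilon^2$ that does not depend on $N$), independent of $(X_{t_j})_j$. For samples $U_{t_j}$ write $\Delta U_{t_j}=U_{t_{j+1}}-U_{t_j}$ and $J_k^{(U)}=N^{-1/2}\sum_{j=1}^N\Delta U_{t_j}e^{-2\pi i t_jf_k}$. Let $$\widehat{\langle X,X\rangle}^{(b)}_T=\sum_{j=1}^N(\Delta Y_{t_j})^2=\sum_{k=0}^{N-1}|J^{(Y)}_k|^2,\qquad \widehat{\langle X,X\rangle}^{(u)}_T=\sum_{j=1}^N(\Delta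 X_{t_j})^2,$$ the first being the naive estimator (the second equality is part of the claim), and let $\tilde{\mathcal S}^{(X)}_{k,k}=\mathrm E|\tilde J^{(X)}_k|^2$, where $\tilde J^{(X)}_k=J^{(M)}_k$ is the transform of the increments of $M_t=\int_0^t\sigma_s\,dB_s$. Then all these random variables are integrable and, as $N\to\infty$, $$\mathrm E\,\widehat{\langle X,X\rangle}^{(b)}_T=\sum_{k=0}^{N-1}\Big(\tilde{\mathcal S}^{(X)}_{k,k}+\sigma_\varepsilon^2\,|2\sin(\pi f_k\Delta t)|^2\Big)+O\big(\log(\Delta t)\sqrt{\Delta t}\big)$$ $$=\mathrm E\,\widehat{\langle X,X\rangle}^{(u)}_T+\sum_{k=0}^{N-1}\sigma_\varepsilon^2\,|2\sin(\pi f_k\Delta t)|^2+O\big(\log(\Delta t)\sqrt{\Delta t}\big),$$ where $\mathrm E\,\widehat{\langle X,X\rangle}^{(u)}_T=O(1)$ and $\sum_{k=0}^{N-1}\sigma_\varepsilon^2|2\sin(\pi f_k\Delta t)|^2=O(\Delta t^{-1})$, of exact order $\Delta t^{-1}$ if $\sigma_\varepsilon\neq 0$. -/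

import Mathlib

open MeasureTheory ProbabilityTheory Filter Asymptotics
open scoped NNReal ENNReal Topology

namespace NoisyIto

noncomputable section

/-! ### Brownian motion on a filtered space and the Itô integral -/

/-- `B` is a standard one-dimensional Brownian motion relative to the filtration `𝓕`. -/
structure IsBrownianFor {Ω : Type*} {mΩ : MeasurableSpace Ω} (𝓕 : Filtration ℝ≥0 mΩ)
    (P : Measure Ω) (B : ℝ≥0 → Ω → ℝ) : Prop where
  brownian : IsBrownianReal B P
  adapted : StronglyAdapted 𝓕 B
  indep_increment : ∀ s t : ℝ≥0, s ≤ t →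
    Indep (MeasurableSpace.comap (fun ω => B t ω - B s ω) inferInstance) (𝓕 s) P

/-- A simple (elementary predictable) process
`H = ∑_{i < size} ξ_i 1_{(τ_i, τ_{i+1}]}` with deterministic times `τ_0 ≤ τ_1 ≤ …` and bounded
`𝓕_{τ_i}`-measurable coefficients `ξ_i`. -/
structure SimpleProcess {Ω : Type*} {mΩ : MeasurableSpace Ω} (𝓕 : Filtration ℝ≥0 mΩ) where
  size : ℕ
  time : ℕ → ℝ≥0
  mono : Monotone time
  coef : ℕ → Ω → ℝ
  measurable_coef : ∀ i, StronglyMeasurable[𝓕 (time i)] (coef i)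
  bounded_coef : ∃ C : ℝ, ∀ i ω, |coef i ω| ≤ C

/-- The value `H_t(ω)` of a simple process. -/
def SimpleProcess.eval {Ω : Type*} {mΩ : MeasurableSpace Ω} {𝓕 : Filtration ℝ≥0 mΩ}
    (H : SimpleProcess 𝓕) (t : ℝ≥0) (ω : Ω) : ℝ :=
  ∑ i ∈ Finset.range H.size,
    (Set.Ioc (H.time i) (H.time (i + 1))).indicator (fun _ => H.coef i ω) t

/-- The elementary stochastic integral
`∫_0^t H dB = ∑_i ξ_i (B_{τ_{i+1} ∧ t} - B_{τ_i ∧ t})`. -/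
def SimpleProcess.integral {Ω : Type*} {mΩ : MeasurableSpace Ω} {𝓕 : Filtration ℝ≥0 mΩ}
    (H : SimpleProcess 𝓕) (B : ℝ≥0 → Ω → ℝ) (t : ℝ≥0) (ω : Ω) : ℝ :=
  ∑ i ∈ Finset.range H.size,
    H.coef i ω * (B (min (H.time (i + 1)) t) ω - B (min (H.time i) t) ω)

/-- `E ∫_0^T u_s² ds`, as an extended nonnegative number. -/
def energy {Ω : Type*} {mΩ : MeasurableSpace Ω} (P : Measure Ω) (T : ℝ≥0)
    (u : ℝ≥0 → Ω → ℝ) : ℝ≥0∞ :=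
  ∫⁻ ω, (∫⁻ s in Set.Icc (0 : ℝ) T, ‖u s.toNNReal ω‖ₑ ^ 2) ∂P

/-- `M_t = ∫_0^t σ_s dB_s` for `t ∈ [0, T]`: the Itô integral of the progressively measurable
process `σ` with `E ∫_0^T σ_s² ds < ∞`, that is, a version with continuous paths of the `L²`-limit
of the elementary integrals of simple processes converging to `σ` in `L²([0, T] × Ω)`. -/
structure IsItoIntegral {Ω : Type*} {mΩ : MeasurableSpace Ω} (𝓕 : Filtration ℝ≥0 mΩ)
    (P : Measure Ω) (B : ℝ≥0 → Ω → ℝ) (T : ℝ≥0) (σ M : ℝ≥0 → Ω → ℝ) : Prop where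
  progressive : IsStronglyProgressive 𝓕 σ
  energy_lt_top : energy P T σ < ∞
  memLp : ∀ t ≤ T, MemLp (M t) 2 P
  limit : ∃ H : ℕ → SimpleProcess 𝓕,
    Tendsto (fun n => energy P T (fun s ω => (H n).eval s ω - σ s ω)) atTop (𝓝 0) ∧
    ∀ t ≤ T, Tendsto (fun n => eLpNorm (fun ω => (H n).integral B t ω - M t ω) 2 P) atTop (𝓝 0)
  continuous : ∀ᵐ ω ∂P, ContinuousOn (fun t => M t ω) (Set.Icc 0 T)

/-- `X` is an Itô process on `[0, T]`, `dX_t = μ_t dt + σ_t dB_t`, with martingale part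
`M_t = ∫_0^t σ_s dB_s`. -/
structure IsItoProcess {Ω : Type*} {mΩ : MeasurableSpace Ω} (𝓕 : Filtration ℝ≥0 mΩ)
    (P : Measure Ω) (B : ℝ≥0 → Ω → ℝ) (T : ℝ≥0) (μ σ M X : ℝ≥0 → Ω → ℝ) : Prop where
  brownian : IsBrownianFor 𝓕 P B
  drift_progressive : IsStronglyProgressive 𝓕 μ
  drift_integrable : ∀ᵐ ω ∂P, IntegrableOn (fun s : ℝ => μ s.toNNReal ω) (Set.Icc (0 : ℝ) T)
  martingale_part : IsItoIntegral 𝓕 P B T σ M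
  initial : StronglyMeasurable[𝓕 0] (X 0)
  decomposition : ∀ᵐ ω ∂P, ∀ t ≤ T,
    X t ω = X 0 ω + (∫ s in (0 : ℝ)..t, μ s.toNNReal ω) + M t ω

/-! ### Sampling, realized volatility and the discrete Fourier transform -/

/-- The sampling interval `Δt = T / N`. -/
def step (T : ℝ≥0) (N : ℕ) : ℝ := (T : ℝ) / N

/-- The `j`-th sampling time `j Δt`, with `j = 0, …, N`. -/
def sampleTime (T : ℝ≥0) (N j : ℕ) : ℝ≥0 := j * (T / N)

/-- The Fourier frequency `f_k = k / T`. -/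
def freq (T : ℝ≥0) (k : ℕ) : ℝ := (k : ℝ) / T

/-- `J_k = N^{-1/2} ∑_j (U_{j+1} - U_j) exp(-2π i t_j f_k)`, the discrete Fourier transform of the
increments of the `N + 1` samples `U_0, …, U_N`. -/
def dft (T : ℝ≥0) (N : ℕ) (U : ℕ → ℝ) (k : ℕ) : ℂ :=
  (Real.sqrt (1 / N) : ℂ) * ∑ j ∈ Finset.range N, ((U (j + 1) - U j : ℝ) : ℂ) *
    Complex.exp (-2 * Real.pi * Complex.I * (sampleTime T N j : ℝ) * freq T k)

/-- The realized volatility `∑_j (U_{j+1} - U_j)²` of the samples `U_0, …, U_N`. -/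
def realizedVol (N : ℕ) (U : ℕ → ℝ) : ℝ :=
  ∑ j ∈ Finset.range N, (U (j + 1) - U j) ^ 2

/-- The samples of the path `t ↦ Z_t(ω)` at the sampling times. -/
def samples {Ω : Type*} (T : ℝ≥0) (N : ℕ) (Z : ℝ≥0 → Ω → ℝ) (ω : Ω) (j : ℕ) : ℝ :=
  Z (sampleTime T N j) ω

/-- The observations `Y_{t_j} = X_{t_j} + ε_{t_j}`. -/
def observed {Ω : Type*} (T : ℝ≥0) (N : ℕ) (X : ℝ≥0 → Ω → ℝ) (ε : ℕ → Ω → ℝ) (ω : Ω)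
    (j : ℕ) : ℝ :=
  samples T N X ω j + ε j ω

/-- `S̃_{k,k} = E |J̃_k|²`, where `J̃_k` is the discrete Fourier transform of the increments
`∫_{t_j}^{t_{j+1}} σ_s dB_s` of the martingale part `M`. -/
def spectrum {Ω : Type*} {mΩ : MeasurableSpace Ω} (P : Measure Ω) (T : ℝ≥0) (N : ℕ)
    (M : ℝ≥0 → Ω → ℝ) (k : ℕ) : ℝ :=
  ∫ ω, ‖dft T N (samples T N M ω) k‖ ^ 2 ∂P

/-- `σ_ε² |2 sin(π f_k Δt)|²`. -/
def noiseSpectrum (T : ℝ≥0) (N : ℕ) (σε : ℝ) (k : ℕ) : ℝ :=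
  σε ^ 2 * |2 * Real.sin (Real.pi * freq T k * step T N)| ^ 2

/-- `ε_0, …, ε_N` is white noise with variance `σ_ε²`: centred, with variance `σ_ε²` and pairwise
uncorrelated. -/
structure IsWhiteNoise {Ω : Type*} {mΩ : MeasurableSpace Ω} (P : Measure Ω) (N : ℕ) (σε : ℝ)
    (ε : ℕ → Ω → ℝ) : Prop where
  memLp : ∀ j ≤ N, MemLp (ε j) 2 P
  mean_zero : ∀ j ≤ N, ∫ ω, ε j ω ∂P = 0
  variance : ∀ j ≤ N, ∫ ω, ε j ω ^ 2 ∂P = σε ^ 2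
  uncorrelated : ∀ i ≤ N, ∀ j ≤ N, i ≠ j → ∫ ω, ε i ω * ε j ω ∂P = 0

end

end NoisyIto

/-! Parseval, applied path by path, identifies the total power over the frequencies with the
realized volatility, so the whole claim reduces to expected sums of squared increments
(`realizedVol_eq_sum_norm_dft_sq`, `sum_spectrum`).

The noise contributes no error. Independence and centring kill its cross term with `X`, leaving `2
σε ^ 2` per increment (`integral_realizedVol_observed`), and for `N ≥ 2` the noise spectrum sums to
exactly `2 * N * σε ^ 2` (`sum_noiseSpectrum`).

The only error is the drift's. Write an increment of `X` as `a + m`, with `a` from the drift and `m`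
from `M`. Cauchy-Schwarz bounds the sum of `E a ^ 2` by `Δt` times the energy of `μ`. Orthogonality
of martingale increments makes the sum of `E m ^ 2` equal to `E (M T - M 0) ^ 2`, whatever `N` is. A
weighted AM-GM inequality with weight `√Δt` then gives an error `O(√Δt)`
(`IsItoProcess.abs_integral_realizedVol_sub_le`); the logarithm in the statement is slack. -/

namespace NoisyIto

/-! ### Discrete Fourier analysis: Parseval and the total noise power -/

/-- **Parseval's identity** for the discrete Fourier transform given by a primitive root of unity. -/
theorem sum_norm_sum_mul_pow_sq {N : ℕ} {w : ℂ} (hw : IsPrimitiveRoot w N) (hN : N ≠ 0)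
    (d : ℕ → ℝ) :
    ∑ k ∈ Finset.range N, ‖∑ j ∈ Finset.range N, (d j : ℂ) * w ^ (j * k)‖ ^ 2 =
      N * ∑ j ∈ Finset.range N, d j ^ 2 := by
  have hnorm : ‖w‖ = 1 := hw.norm'_eq_one hN
  have hconj : w * (starRingEnd ℂ) w = 1 := by
    rw [Complex.mul_conj, Complex.normSq_eq_norm_sq, hnorm]; norm_num
  have hwne : w ≠ 0 := hw.ne_zero hN
  have hconj' : (starRingEnd ℂ) w = w⁻¹ := eq_inv_of_mul_eq_one_right hconj
  -- Orthogonality of characters: off the diagonal the ratio is an `N`-th root of unity other than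
  -- 1, so its geometric sum vanishes.
  have hgeom : ∀ j ∈ Finset.range N, ∀ l ∈ Finset.range N,
      ∑ k ∈ Finset.range N, w ^ (j * k) * (w⁻¹) ^ (l * k) = if j = l then (N : ℂ) else 0 := by
    intro j hj l hl
    have h1 : ∀ k, w ^ (j * k) * (w⁻¹) ^ (l * k) = (w ^ j * (w⁻¹) ^ l) ^ k := by
      intro k; rw [mul_pow, pow_mul, pow_mul]
    simp only [h1]
    split_ifs with hjl
    · subst hjl
      simp [hwne]
    · have hz : w ^ j * (w⁻¹) ^ l ≠ 1 := by
        intro h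
        apply hjl
        refine hw.pow_inj (Finset.mem_range.1 hj) (Finset.mem_range.1 hl) ?_
        rw [inv_pow] at h
        exact (mul_inv_eq_one₀ (pow_ne_zero _ hwne)).1 h
      have hp : (w ^ j * (w⁻¹) ^ l) ^ N = 1 := by
        rw [mul_pow, ← pow_mul, ← pow_mul, mul_comm j, mul_comm l, pow_mul, pow_mul, inv_pow,
          hw.pow_eq_one]; simp
      have := mul_neg_geom_sum (w ^ j * (w⁻¹) ^ l) N
      rw [hp, sub_self] at this
      exact (mul_eq_zero.1 this).resolve_left (sub_ne_zero.2 hz.symm)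
  have key : (∑ k ∈ Finset.range N,
      ((‖∑ j ∈ Finset.range N, (d j : ℂ) * w ^ (j * k)‖ ^ 2 : ℝ) : ℂ)) =
      ((N * ∑ j ∈ Finset.range N, d j ^ 2 : ℝ) : ℂ) := by
    have h2 : ∀ k, ((‖∑ j ∈ Finset.range N, (d j : ℂ) * w ^ (j * k)‖ ^ 2 : ℝ) : ℂ) =
        ∑ j ∈ Finset.range N, ∑ l ∈ Finset.range N,
          (d j : ℂ) * d l * (w ^ (j * k) * (w⁻¹) ^ (l * k)) := by
      intro k
      rw [← Complex.normSq_eq_norm_sq, ← Complex.mul_conj, map_sum, Finset.sum_mul_sum]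
      refine Finset.sum_congr rfl fun j _ => Finset.sum_congr rfl fun l _ => ?_
      rw [map_mul, map_pow, hconj', Complex.conj_ofReal]
      ring
    simp only [h2]
    rw [Finset.sum_comm]
    push_cast
    rw [Finset.mul_sum]
    refine Finset.sum_congr rfl fun j hj => ?_
    rw [Finset.sum_comm]
    simp only [← Finset.mul_sum]
    rw [Finset.sum_congr rfl fun l hl => by rw [hgeom j hj l hl]]
    simp only [mul_ite, mul_zero, Finset.sum_ite_eq, if_pos hj]
    ring
  exact_mod_cast key

theorem sampleTime_mul_freq {T : ℝ≥0} (hT : 0 < T) (N j k : ℕ) :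
    (sampleTime T N j : ℝ) * freq T k = j * k / N := by
  have : (T : ℝ) ≠ 0 := by exact_mod_cast hT.ne'
  simp only [sampleTime, freq]
  push_cast
  field_simp

/-- `T` cancels between sampling times and frequencies, so the kernel consists of powers of an
inverse primitive root of unity, as Parseval requires. -/
theorem dft_eq {T : ℝ≥0} (hT : 0 < T) (N : ℕ) (U : ℕ → ℝ) (k : ℕ) :
    dft T N U k = (Real.sqrt (1 / N) : ℂ) * ∑ j ∈ Finset.range N, ((U (j + 1) - U j : ℝ) : ℂ) *
      (Complex.exp (2 * Real.pi * Complex.I / N))⁻¹ ^ (j * k) := by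
  unfold dft
  congr 1
  refine Finset.sum_congr rfl fun j _ => ?_
  congr 1
  rw [← Complex.exp_neg, ← Complex.exp_nat_mul]
  congr 1
  have := congrArg (fun x : ℝ => (x : ℂ)) (sampleTime_mul_freq hT N j k)
  push_cast at this ⊢
  rw [mul_assoc, this]
  ring

/-- The realized volatility is the total power of the increments in the frequency domain. -/
theorem realizedVol_eq_sum_norm_dft_sq {T : ℝ≥0} (hT : 0 < T) {N : ℕ} (hN : 1 ≤ N) (U : ℕ → ℝ) :
    realizedVol N U = ∑ k ∈ Finset.range N, ‖dft T N U k‖ ^ 2 := by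
  have hN0 : N ≠ 0 := by omega
  have hw := (Complex.isPrimitiveRoot_exp N hN0).inv
  have h := sum_norm_sum_mul_pow_sq hw hN0 fun j => U (j + 1) - U j
  simp only [dft_eq hT, norm_mul, mul_pow]
  rw [← Finset.mul_sum, h, Complex.norm_real, Real.norm_eq_abs, sq_abs,
    Real.sq_sqrt (by positivity)]
  unfold realizedVol
  field_simp

/-- By the half-angle formula the sines become a constant minus cosines, and the cosines add up to
the real part of the sum of all `N`-th roots of unity. That sum is zero only for `N ≥ 2`; at `N = 1`
the left side is 0. -/
theorem sum_noiseSpectrum {T : ℝ≥0} (hT : 0 < T) {N : ℕ} (hN : 2 ≤ N) (σε : ℝ) :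
    ∑ k ∈ Finset.range N, noiseSpectrum T N σε k = 2 * N * σε ^ 2 := by
  have hT' : (T : ℝ) ≠ 0 := by exact_mod_cast hT.ne'
  have hN0 : N ≠ 0 := by omega
  have hcos : ∑ k ∈ Finset.range N, Real.cos (2 * (Real.pi * k / N)) = 0 := by
    have h := (Complex.isPrimitiveRoot_exp N hN0).geom_sum_eq_zero (by omega)
    have h' := congrArg Complex.re h
    rw [Complex.re_sum, Complex.zero_re] at h'
    rw [← h']
    refine Finset.sum_congr rfl fun k _ => ?_
    rw [← Complex.exp_nat_mul, ← Complex.exp_ofReal_mul_I_re]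
    congr 2
    push_cast
    ring
  have hterm : ∀ k, noiseSpectrum T N σε k =
      σε ^ 2 * (2 - 2 * Real.cos (2 * (Real.pi * k / N))) := by
    intro k
    have : Real.pi * freq T k * step T N = Real.pi * k / N := by
      unfold freq step; field_simp
    rw [noiseSpectrum, sq_abs, this, mul_pow, Real.sin_sq_eq_half_sub]
    ring
  simp only [hterm]
  rw [← Finset.mul_sum, Finset.sum_sub_distrib, ← Finset.mul_sum, hcos]
  simp
  ring

end NoisyIto

/-! ### Orthogonality of Itô integral increments -/

namespace NoisyIto

section StochasticIntegral

variable {Ω : Type*} {mΩ : MeasurableSpace Ω} {𝓕 : Filtration ℝ≥0 mΩ} {P : Measure Ω}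
  {B : ℝ≥0 → Ω → ℝ}

theorem IsBrownianFor.memLp (hB : IsBrownianFor 𝓕 P B) (t : ℝ≥0) : MemLp (B t) 2 P :=
  (hB.brownian.isGaussianProcess.hasGaussianLaw_eval t).memLp_two

/-- An increment of Brownian motion is orthogonal to every integrable random variable that is
measurable with respect to the past. -/
theorem IsBrownianFor.integral_mul_sub [IsProbabilityMeasure P] (hB : IsBrownianFor 𝓕 P B)
    {a b : ℝ≥0} (hab : a ≤ b) {Z : Ω → ℝ} (hZ : StronglyMeasurable[𝓕 a] Z) :
    ∫ ω, Z ω * (B b ω - B a ω) ∂P = 0 := by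
  have hind : IndepFun Z (fun ω => B b ω - B a ω) P := by
    rw [IndepFun_iff_Indep]
    exact indep_of_indep_of_le_left (hB.indep_increment a b hab).symm hZ.measurable.comap_le
  rw [hind.integral_fun_mul_eq_mul_integral (hZ.mono (𝓕.le a)).aestronglyMeasurable
    ((hB.memLp b).sub (hB.memLp a)).aestronglyMeasurable,
    integral_sub (hB.brownian.integrable_eval b) (hB.brownian.integrable_eval a),
    hB.brownian.integral_eval, hB.brownian.integral_eval]
  simp

theorem SimpleProcess.stronglyMeasurable_integral (H : SimpleProcess 𝓕)
    (hB : IsBrownianFor 𝓕 P B) (t : ℝ≥0) : StronglyMeasurable[𝓕 t] (H.integral B t) := by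
  unfold SimpleProcess.integral
  refine Finset.stronglyMeasurable_fun_sum _ fun i _ => ?_
  rcases le_total (H.time i) t with h | h
  · refine ((H.measurable_coef i).mono (𝓕.mono h)).mul (.sub ?_ ?_)
    · exact (hB.adapted _).mono (𝓕.mono (min_le_right _ _))
    · exact (hB.adapted _).mono (𝓕.mono (min_le_right _ _))
  -- Here the coefficient need not be measurable at time `t`, but both truncated times equal `t` and
  -- the term vanishes.
  · simp only [min_eq_right h, min_eq_right (h.trans (H.mono i.le_succ)), sub_self, mul_zero]
    exact stronglyMeasurable_const

theorem SimpleProcess.memLp_coef_mul (H : SimpleProcess 𝓕) (i : ℕ) {f : Ω → ℝ} {p : ℝ≥0∞}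
    (hf : MemLp f p P) : MemLp (fun ω => H.coef i ω * f ω) p P := by
  obtain ⟨C, hC⟩ := H.bounded_coef
  have hm : AEStronglyMeasurable (H.coef i) P :=
    ((H.measurable_coef i).mono (𝓕.le _)).aestronglyMeasurable
  have := hf.mul (memLp_top_of_bound hm C (.of_forall fun ω => by simpa using hC i ω)) (r := p)
  exact this

theorem SimpleProcess.memLp_integral (H : SimpleProcess 𝓕) (hB : IsBrownianFor 𝓕 P B)
    (t : ℝ≥0) : MemLp (H.integral B t) 2 P := by
  unfold SimpleProcess.integral
  exact memLp_finsetSum _ fun i _ => H.memLp_coef_mul i ((hB.memLp _).sub (hB.memLp _))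

/-- Clipping to `[s, t]` moves every evaluation time to `s` or later, so that in the martingale
property each Brownian increment lies in the future of `s`. -/
theorem apply_min_sub_apply_min (f : ℝ≥0 → ℝ) {s t : ℝ≥0} (hst : s ≤ t) (x : ℝ≥0) :
    f (min x t) - f (min x s) = f (max s (min x t)) - f s := by
  rcases le_total x s with h | h
  · simp [h, h.trans hst]
  · simp [h, hst]

theorem SimpleProcess.integral_sub_integral (H : SimpleProcess 𝓕) {s t : ℝ≥0} (hst : s ≤ t)
    (ω : Ω) : H.integral B t ω - H.integral B s ω = ∑ i ∈ Finset.range H.size, H.coef i ω *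
      (B (max s (min (H.time (i + 1)) t)) ω - B (max s (min (H.time i) t)) ω) := by
  unfold SimpleProcess.integral
  rw [← Finset.sum_sub_distrib]
  refine Finset.sum_congr rfl fun i _ => ?_
  linear_combination H.coef i ω * (apply_min_sub_apply_min (B · ω) hst (H.time (i + 1)) -
    apply_min_sub_apply_min (B · ω) hst (H.time i))

/-- The elementary stochastic integral is a martingale: its increments are orthogonal to the
past. -/
theorem SimpleProcess.integral_mul_integral_sub [IsProbabilityMeasure P] (H : SimpleProcess 𝓕)
    (hB : IsBrownianFor 𝓕 P B) {s t : ℝ≥0} (hst : s ≤ t) {Z : Ω → ℝ}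
    (hZ : StronglyMeasurable[𝓕 s] Z) (hZ2 : MemLp Z 2 P) :
    ∫ ω, Z ω * (H.integral B t ω - H.integral B s ω) ∂P = 0 := by
  simp only [H.integral_sub_integral hst, Finset.mul_sum]
  rw [integral_finsetSum]
  · refine Finset.sum_eq_zero fun i _ => ?_
    -- If the `i`-th interval starts by time `t`, both `Z` and the coefficient are known at the left
    -- end of the clipped interval; otherwise the clipped interval is degenerate.
    rcases le_total (H.time i) t with h | h
    · have hmono : max s (min (H.time i) t) ≤ max s (min (H.time (i + 1)) t) :=
        max_le_max le_rfl (min_le_min (H.mono i.le_succ) le_rfl)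
      have hm : StronglyMeasurable[𝓕 (max s (min (H.time i) t))] fun ω => Z ω * H.coef i ω :=
        (hZ.mono (𝓕.mono (le_max_left _ _))).mul ((H.measurable_coef i).mono
          (𝓕.mono (by rw [min_eq_left h]; exact le_max_right _ _)))
      simpa only [mul_assoc] using hB.integral_mul_sub hmono hm
    · simp [min_eq_right h, min_eq_right (h.trans (H.mono i.le_succ))]
  · exact fun i _ => hZ2.integrable_mul (H.memLp_coef_mul i ((hB.memLp _).sub (hB.memLp _)))

/-- Expectations of products pass to limits in `L²`. -/
theorem tendsto_integral_mul_of_tendsto_eLpNorm {f g : ℕ → Ω → ℝ} {f₀ g₀ : Ω → ℝ}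
    (hf : ∀ n, MemLp (f n) 2 P) (hg : ∀ n, MemLp (g n) 2 P) (hf₀ : MemLp f₀ 2 P)
    (hg₀ : MemLp g₀ 2 P) (hfl : Tendsto (fun n => eLpNorm (f n - f₀) 2 P) atTop (𝓝 0))
    (hgl : Tendsto (fun n => eLpNorm (g n - g₀) 2 P) atTop (𝓝 0)) :
    Tendsto (fun n => ∫ ω, f n ω * g n ω ∂P) atTop (𝓝 (∫ ω, f₀ ω * g₀ ω ∂P)) := by
  have h1 := (Lp.tendsto_Lp_iff_tendsto_eLpNorm'' f hf f₀ hf₀).2 hfl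
  have h2 := (Lp.tendsto_Lp_iff_tendsto_eLpNorm'' g hg g₀ hg₀).2 hgl
  have key : ∀ {u v : Ω → ℝ} (hu : MemLp u 2 P) (hv : MemLp v 2 P),
      inner ℝ (hu.toLp u) (hv.toLp v) = ∫ ω, u ω * v ω ∂P := by
    intro u v hu hv
    rw [L2.inner_def]
    refine integral_congr_ae ?_
    filter_upwards [hu.coeFn_toLp, hv.coeFn_toLp] with ω h1 h2
    rw [h1, h2]
    simp [mul_comm]
  simpa only [key] using h1.inner h2 (𝕜 := ℝ)

theorem tendsto_eLpNorm_sub_sub {f g : ℕ → Ω → ℝ} {f₀ g₀ : Ω → ℝ}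
    (hf : ∀ n, MemLp (f n) 2 P) (hg : ∀ n, MemLp (g n) 2 P) (hf₀ : MemLp f₀ 2 P)
    (hg₀ : MemLp g₀ 2 P) (hfl : Tendsto (fun n => eLpNorm (f n - f₀) 2 P) atTop (𝓝 0))
    (hgl : Tendsto (fun n => eLpNorm (g n - g₀) 2 P) atTop (𝓝 0)) :
    Tendsto (fun n => eLpNorm ((f n - g n) - (f₀ - g₀)) 2 P) atTop (𝓝 0) := by
  refine tendsto_of_tendsto_of_tendsto_of_le_of_le tendsto_const_nhds
    (by simpa using hfl.add hgl) (fun _ => zero_le) fun n => ?_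
  rw [sub_sub_sub_comm]
  exact eLpNorm_sub_le ((hf n).sub hf₀).aestronglyMeasurable
    ((hg n).sub hg₀).aestronglyMeasurable (by norm_num)

variable {T : ℝ≥0} {σ M : ℝ≥0 → Ω → ℝ}

/-- The increments of an Itô integral over non-overlapping intervals are orthogonal. -/
theorem IsItoIntegral.integral_increment_mul_increment [IsProbabilityMeasure P]
    (hM : IsItoIntegral 𝓕 P B T σ M) (hB : IsBrownianFor 𝓕 P B) {u v s t : ℝ≥0} (huv : u ≤ v)
    (hvs : v ≤ s) (hst : s ≤ t) (htT : t ≤ T) :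
    ∫ ω, (M v ω - M u ω) * (M t ω - M s ω) ∂P = 0 := by
  obtain ⟨H, -, hH⟩ := hM.limit
  have hsT := hst.trans htT
  have hvT := hvs.trans hsT
  have huT := huv.trans hvT
  have hI : ∀ r n, MemLp ((H n).integral B r) 2 P := fun r n => (H n).memLp_integral hB r
  -- One approximating sequence `H` serves all four times, so both increments converge in `L²` along
  -- it and their vanishing inner product passes to the limit.
  have lim : ∀ {a b : ℝ≥0}, a ≤ T → b ≤ T → Tendsto (fun n =>
      eLpNorm (((H n).integral B b - (H n).integral B a) - (M b - M a)) 2 P) atTop (𝓝 0) :=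
    fun ha hb => tendsto_eLpNorm_sub_sub (hI _) (hI _) (hM.memLp _ hb) (hM.memLp _ ha)
      (hH _ hb) (hH _ ha)
  have h := tendsto_integral_mul_of_tendsto_eLpNorm (fun n => (hI v n).sub (hI u n))
    (fun n => (hI t n).sub (hI s n)) ((hM.memLp v hvT).sub (hM.memLp u huT))
    ((hM.memLp t htT).sub (hM.memLp s hsT)) (lim huT hvT) (lim hsT htT)
  refine tendsto_nhds_unique h ?_
  have h0 : ∀ n, ∫ ω, ((H n).integral B v - (H n).integral B u) ω *
      ((H n).integral B t - (H n).integral B s) ω ∂P = 0 := fun n =>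
    (H n).integral_mul_integral_sub hB hst
      (((H n).stronglyMeasurable_integral hB v).mono (𝓕.mono hvs) |>.sub
        (((H n).stronglyMeasurable_integral hB u).mono (𝓕.mono (huv.trans hvs))))
      ((hI v n).sub (hI u n))
  simp only [h0]
  exact tendsto_const_nhds

theorem sampleTime_mono (T : ℝ≥0) (N : ℕ) : Monotone (sampleTime T N) := fun i j h => by
  unfold sampleTime
  gcongr

theorem sampleTime_self (T : ℝ≥0) {N : ℕ} (hN : 1 ≤ N) : sampleTime T N N = T := by
  have : (N : ℝ≥0) ≠ 0 := by positivity
  unfold sampleTime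
  field_simp

theorem sampleTime_le (T : ℝ≥0) {N j : ℕ} (hN : 1 ≤ N) (hj : j ≤ N) : sampleTime T N j ≤ T :=
  (sampleTime_mono T N hj).trans_eq (sampleTime_self T hN)

theorem IsItoIntegral.memLp_increment (hM : IsItoIntegral 𝓕 P B T σ M) {N j : ℕ} (hj : j < N) :
    MemLp (fun ω => samples T N M ω (j + 1) - samples T N M ω j) 2 P :=
  (hM.memLp _ (sampleTime_le T (by omega) hj)).sub
    (hM.memLp _ (sampleTime_le T (by omega) hj.le))

theorem integrable_realizedVol {N : ℕ} {U : Ω → ℕ → ℝ}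
    (hU : ∀ j < N, MemLp (fun ω => U ω (j + 1) - U ω j) 2 P) :
    Integrable (fun ω => realizedVol N (U ω)) P :=
  integrable_finsetSum _ fun j hj => (hU j (Finset.mem_range.1 hj)).integrable_sq

/-- The expected realized volatility of an Itô integral does not depend on the sampling
frequency. -/
theorem IsItoIntegral.integral_realizedVol [IsProbabilityMeasure P]
    (hM : IsItoIntegral 𝓕 P B T σ M) (hB : IsBrownianFor 𝓕 P B) {N : ℕ} (hN : 1 ≤ N) :
    ∫ ω, realizedVol N (samples T N M ω) ∂P = ∫ ω, (M T ω - M 0 ω) ^ 2 ∂P := by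
  -- Squaring this telescoping sum and taking expectations leaves only the diagonal, by
  -- orthogonality.
  have htel : ∀ ω, M T ω - M 0 ω =
      ∑ j ∈ Finset.range N, (samples T N M ω (j + 1) - samples T N M ω j) := by
    intro ω
    rw [Finset.sum_range_sub]
    simp only [samples, sampleTime_self T hN]
    simp [sampleTime]
  have hL : ∀ j ∈ Finset.range N,
      MemLp (fun ω => samples T N M ω (j + 1) - samples T N M ω j) 2 P :=
    fun j hj => hM.memLp_increment (Finset.mem_range.1 hj)
  have hmul : ∀ i ∈ Finset.range N, ∀ j ∈ Finset.range N,
      Integrable (fun ω => (samples T N M ω (i + 1) - samples T N M ω i) *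
        (samples T N M ω (j + 1) - samples T N M ω j)) P :=
    fun i hi j hj => (hL i hi).integrable_mul (hL j hj)
  simp only [htel, sq (∑ j ∈ Finset.range N, _), Finset.sum_mul_sum, realizedVol]
  rw [integral_finsetSum _ fun j hj => (hL j hj).integrable_sq, integral_finsetSum _ fun i hi =>
    integrable_finsetSum _ (hmul i hi)]
  refine Finset.sum_congr rfl fun i hi => ?_
  rw [integral_finsetSum _ (hmul i hi),
    Finset.sum_eq_single_of_mem i hi]
  · simp only [sq]
  · intro j hj hji
    have hi' := Finset.mem_range.1 hi
    have hj' := Finset.mem_range.1 hj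
    rcases lt_or_gt_of_ne hji with h | h
    · simp only [mul_comm (samples T N M _ (i + 1) - samples T N M _ i)]
      exact hM.integral_increment_mul_increment hB (sampleTime_mono T N j.le_succ)
        (sampleTime_mono T N h) (sampleTime_mono T N i.le_succ) (sampleTime_le T hN hi')
    · exact hM.integral_increment_mul_increment hB (sampleTime_mono T N i.le_succ)
        (sampleTime_mono T N h) (sampleTime_mono T N j.le_succ) (sampleTime_le T hN hj')

end StochasticIntegral

end NoisyIto

/-! ### The drift over the sampling intervals -/

namespace NoisyIto

section Drift

variable {Ω : Type*} {mΩ : MeasurableSpace Ω} {𝓕 : Filtration ℝ≥0 mΩ} {P : Measure Ω}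
  {T : ℝ≥0} {μ : ℝ≥0 → Ω → ℝ}

/-- Progressive measurability gives joint measurability up to `T`. Capping time at `T` extends this
to all of `ℝ × Ω` without changing integrals inside `[0, T]`, so measurability of parametric
integrals applies. -/
theorem stronglyMeasurable_uncurry_min (hμ : IsStronglyProgressive 𝓕 μ) (T : ℝ≥0) :
    StronglyMeasurable fun p : ℝ × Ω => μ (min p.1.toNNReal T) p.2 := by
  have h : StronglyMeasurable fun p : Set.Iic T × Ω => μ p.1 p.2 :=
    (hμ T).mono (sup_le_sup_left (MeasurableSpace.comap_mono (𝓕.le T)) _)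
  have hg : Measurable fun p : ℝ × Ω =>
      ((⟨min p.1.toNNReal T, Set.mem_Iic.2 (min_le_right _ _)⟩ : Set.Iic T), p.2) := by
    refine Measurable.prodMk (Measurable.subtype_mk ?_) measurable_snd
    fun_prop
  exact h.comp_measurable hg

theorem min_toNNReal_of_mem_Ioc {a b : ℝ≥0} (hbT : b ≤ T) {r : ℝ} (hr : r ∈ Set.Ioc (a : ℝ) b) :
    min r.toNNReal T = r.toNNReal :=
  min_eq_left ((Real.toNNReal_le_iff_le_coe.2 hr.2).trans hbT)

theorem aestronglyMeasurable_integral_drift (hμ : IsStronglyProgressive 𝓕 μ) {a b : ℝ≥0}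
    (hab : a ≤ b) (hbT : b ≤ T) :
    AEStronglyMeasurable (fun ω => ∫ r in (a : ℝ)..b, μ r.toNNReal ω) P := by
  have h := ((stronglyMeasurable_uncurry_min hμ T).comp_measurable
    measurable_swap).integral_prod_right' (ν := volume.restrict (Set.Ioc (a : ℝ) b))
  refine h.aestronglyMeasurable.congr (.of_forall fun ω => ?_)
  beta_reduce
  rw [intervalIntegral.integral_of_le (by exact_mod_cast hab)]
  exact setIntegral_congr_fun measurableSet_Ioc fun r hr => by
    simp only [Function.comp, Prod.swap, min_toNNReal_of_mem_Ioc hbT hr]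

/-- The Cauchy-Schwarz inequality for the drift over an interval. -/
theorem enorm_integral_drift_sq_le (hμ : IsStronglyProgressive 𝓕 μ) {a b : ℝ≥0}
    (hab : a ≤ b) (hbT : b ≤ T) (ω : Ω) :
    ‖∫ r in (a : ℝ)..b, μ r.toNNReal ω‖ₑ ^ 2 ≤
      ENNReal.ofReal (b - a) * ∫⁻ r in Set.Ioc (a : ℝ) b, ‖μ r.toNNReal ω‖ₑ ^ 2 := by
  have hm : AEStronglyMeasurable (fun r : ℝ => μ r.toNNReal ω)
      (volume.restrict (Set.Ioc (a : ℝ) b)) := by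
    refine ((stronglyMeasurable_uncurry_min hμ T).comp_measurable
      (measurable_prodMk_right (y := ω))).aestronglyMeasurable.congr ?_
    filter_upwards [ae_restrict_mem measurableSet_Ioc] with r hr
    simp only [Function.comp, min_toNNReal_of_mem_Ioc hbT hr]
  rw [intervalIntegral.integral_of_le (by exact_mod_cast hab)]
  -- Comparison of `L¹` and `L²` norms on an interval of finite length; squaring turns the root of
  -- the length into `b - a`.
  have h1 := eLpNorm_le_eLpNorm_mul_rpow_measure_univ (p := 1) (q := 2) (by norm_num) hm
  have h2 := (enorm_integral_le_lintegral_enorm (μ := volume.restrict (Set.Ioc (a : ℝ) b))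
    fun r : ℝ => μ r.toNNReal ω).trans ((eLpNorm_one_eq_lintegral_enorm).symm.trans_le h1)
  have h3 := eLpNorm_nnreal_pow_eq_lintegral (f := fun r : ℝ => μ r.toNNReal ω)
    (μ := volume.restrict (Set.Ioc (a : ℝ) b)) (p := 2) (by norm_num)
  norm_num at h3
  calc _ ≤ (_ : ℝ≥0∞) ^ 2 := pow_le_pow_left₀ zero_le h2 2
    _ = _ := by
      rw [mul_pow, h3, mul_comm]
      congr 1
      rw [← ENNReal.rpow_natCast, ← ENNReal.rpow_mul]
      norm_num

theorem sum_setLIntegral_Ioc {t : ℕ → ℝ} (ht : Monotone t) (g : ℝ → ℝ≥0∞) (n : ℕ) :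
    ∑ j ∈ Finset.range n, ∫⁻ r in Set.Ioc (t j) (t (j + 1)), g r =
      ∫⁻ r in Set.Ioc (t 0) (t n), g r := by
  induction n with
  | zero => simp
  | succ n ih =>
    rw [Finset.sum_range_succ, ih, ← lintegral_union measurableSet_Ioc,
      Set.Ioc_union_Ioc_eq_Ioc (ht n.zero_le) (ht n.le_succ)]
    exact Set.Ioc_disjoint_Ioc_of_le le_rfl

/-- The integral of the drift over the `j`-th sampling interval. -/
noncomputable def driftIncrement (T : ℝ≥0) (N : ℕ) (μ : ℝ≥0 → Ω → ℝ) (j : ℕ) (ω : Ω) : ℝ :=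
  ∫ r in (sampleTime T N j : ℝ)..sampleTime T N (j + 1), μ r.toNNReal ω

theorem sampleTime_succ_sub (T : ℝ≥0) (N j : ℕ) :
    (sampleTime T N (j + 1) : ℝ) - sampleTime T N j = step T N := by
  simp only [sampleTime, step]
  push_cast
  ring

theorem aestronglyMeasurable_driftIncrement (hμ : IsStronglyProgressive 𝓕 μ) {N j : ℕ}
    (hj : j < N) : AEStronglyMeasurable (driftIncrement T N μ j) P :=
  aestronglyMeasurable_integral_drift hμ (sampleTime_mono T N j.le_succ)
    (sampleTime_le T (by omega) hj)

/-- Each interval costs one factor `Δt` by Cauchy-Schwarz, and the intervals tile `(0, T]`. Working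
in `ℝ≥0∞` lets the same bound later supply square-integrability. -/
theorem sum_lintegral_driftIncrement_sq_le (hμ : IsStronglyProgressive 𝓕 μ) {N : ℕ}
    (hN : 1 ≤ N) :
    ∑ j ∈ Finset.range N, ∫⁻ ω, ‖driftIncrement T N μ j ω‖ₑ ^ 2 ∂P ≤
      ENNReal.ofReal (step T N) * energy P T μ := by
  rw [← lintegral_finsetSum' _ fun j hj => ((aestronglyMeasurable_driftIncrement hμ
    (Finset.mem_range.1 hj)).enorm.pow_const 2), energy,
    ← lintegral_const_mul' _ _ ENNReal.ofReal_ne_top]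
  refine lintegral_mono fun ω => ?_
  calc ∑ j ∈ Finset.range N, ‖driftIncrement T N μ j ω‖ₑ ^ 2
      ≤ ∑ j ∈ Finset.range N, ENNReal.ofReal (step T N) *
        ∫⁻ r in Set.Ioc (sampleTime T N j : ℝ) (sampleTime T N (j + 1)),
          ‖μ r.toNNReal ω‖ₑ ^ 2 := by
        refine Finset.sum_le_sum fun j hj => ?_
        have hj := Finset.mem_range.1 hj
        rw [← sampleTime_succ_sub T N j]
        exact enorm_integral_drift_sq_le hμ (sampleTime_mono T N j.le_succ)
          (sampleTime_le T hN hj) ω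
    _ ≤ _ := by
        rw [← Finset.mul_sum, sum_setLIntegral_Ioc (t := fun j => (sampleTime T N j : ℝ))
          (fun i j h => NNReal.coe_le_coe.2 (sampleTime_mono T N h))]
        gcongr
        intro r hr
        rw [sampleTime_self T hN] at hr
        exact ⟨(NNReal.coe_nonneg _).trans hr.1.le, hr.2⟩

theorem memLp_driftIncrement (hμ : IsStronglyProgressive 𝓕 μ) (he : energy P T μ < ∞) {N j : ℕ}
    (hj : j < N) : MemLp (driftIncrement T N μ j) 2 P := by
  refine ⟨aestronglyMeasurable_driftIncrement hμ hj, ?_⟩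
  rw [eLpNorm_lt_top_iff_lintegral_rpow_enorm_lt_top (by norm_num) (by norm_num)]
  have h := sum_lintegral_driftIncrement_sq_le (P := P) (T := T) hμ (N := N) (by omega)
  have h1 := Finset.single_le_sum (f := fun j => ∫⁻ ω, ‖driftIncrement T N μ j ω‖ₑ ^ 2 ∂P)
    (fun _ _ => zero_le) (Finset.mem_range.2 hj)
  simpa using (h1.trans h).trans_lt (ENNReal.mul_lt_top ENNReal.ofReal_lt_top he)

theorem integral_sum_driftIncrement_sq_le (hμ : IsStronglyProgressive 𝓕 μ)
    (he : energy P T μ < ∞) {N : ℕ} (hN : 1 ≤ N) :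
    ∫ ω, ∑ j ∈ Finset.range N, driftIncrement T N μ j ω ^ 2 ∂P ≤
      step T N * (energy P T μ).toReal := by
  have hstep : 0 ≤ step T N := by unfold step; positivity
  have h := ENNReal.toReal_mono (ENNReal.mul_lt_top ENNReal.ofReal_lt_top he).ne
    (sum_lintegral_driftIncrement_sq_le (P := P) (T := T) hμ hN)
  rw [ENNReal.toReal_mul, ENNReal.toReal_ofReal hstep] at h
  refine le_trans (le_of_eq ?_) h
  have hint := fun j (hj : j ∈ Finset.range N) =>
    (memLp_driftIncrement hμ he (Finset.mem_range.1 hj)).integrable_sq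
  rw [integral_finsetSum _ hint, ENNReal.toReal_sum]
  · refine Finset.sum_congr rfl fun j hj => ?_
    rw [integral_eq_lintegral_of_nonneg_ae (.of_forall fun ω => sq_nonneg _)
      (hint j hj).aestronglyMeasurable]
    congr 1
    refine lintegral_congr fun ω => ?_
    rw [← enorm_pow, Real.enorm_of_nonneg (sq_nonneg _)]
  · intro j hj
    have h1 := Finset.single_le_sum (f := fun j => ∫⁻ ω, ‖driftIncrement T N μ j ω‖ₑ ^ 2 ∂P)
      (fun _ _ => zero_le) hj
    exact ((h1.trans (sum_lintegral_driftIncrement_sq_le hμ hN)).trans_lt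
      (ENNReal.mul_lt_top ENNReal.ofReal_lt_top he)).ne

end Drift

/-! ### Effect of drift and noise on the expected realized volatility -/

section Observation

variable {Ω : Type*} {mΩ : MeasurableSpace Ω} {𝓕 : Filtration ℝ≥0 mΩ} {P : Measure Ω}
  {T : ℝ≥0} {B μ σ M X : ℝ≥0 → Ω → ℝ}

theorem IsItoProcess.ae_increment_eq (hX : IsItoProcess 𝓕 P B T μ σ M X) {N j : ℕ}
    (hj : j < N) : ∀ᵐ ω ∂P, samples T N X ω (j + 1) - samples T N X ω j =
      driftIncrement T N μ j ω + (samples T N M ω (j + 1) - samples T N M ω j) := by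
  filter_upwards [hX.decomposition, hX.drift_integrable] with ω hω hi
  have hint : ∀ t ≤ T, IntervalIntegrable (fun s : ℝ => μ s.toNNReal ω) volume 0 t := by
    intro t ht
    refine intervalIntegrable_iff.2 ?_
    rw [Set.uIoc_of_le t.coe_nonneg]
    refine IntegrableOn.mono_set ?_ Set.Ioc_subset_Icc_self
    exact hi.mono_set (Set.Icc_subset_Icc_right (by exact_mod_cast ht))
  have h1 := sampleTime_le T (by omega : 1 ≤ N) hj
  have h0 := sampleTime_le T (by omega : 1 ≤ N) hj.le
  simp only [samples, driftIncrement]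
  rw [hω _ h1, hω _ h0, ← intervalIntegral.integral_interval_sub_left (hint _ h1) (hint _ h0)]
  ring

theorem IsItoProcess.memLp_increment (hX : IsItoProcess 𝓕 P B T μ σ M X)
    (he : energy P T μ < ∞) {N j : ℕ} (hj : j < N) :
    MemLp (fun ω => samples T N X ω (j + 1) - samples T N X ω j) 2 P :=
  ((memLp_driftIncrement hX.drift_progressive he hj).add
    (hX.martingale_part.memLp_increment hj)).ae_eq
      ((hX.ae_increment_eq hj).mono fun _ h => h.symm)

/-- The drift changes the expected realized volatility by `O(√Δt)` only. -/
theorem IsItoProcess.abs_integral_realizedVol_sub_le [IsProbabilityMeasure P]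
    (hX : IsItoProcess 𝓕 P B T μ σ M X) (he : energy P T μ < ∞) {N : ℕ} (hN : 1 ≤ N)
    (hT : 0 < T) :
    |∫ ω, realizedVol N (samples T N X ω) ∂P - ∫ ω, realizedVol N (samples T N M ω) ∂P| ≤
      step T N * (energy P T μ).toReal + √(step T N) *
        ((energy P T μ).toReal + ∫ ω, (M T ω - M 0 ω) ^ 2 ∂P) := by
  have hM := hX.martingale_part
  have hstep : 0 < step T N := by
    have : (0 : ℝ) < T := by exact_mod_cast hT
    unfold step; positivity
  set C := (energy P T μ).toReal
  set r := √(step T N) with hr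
  have hr0 : 0 < r := Real.sqrt_pos.2 hstep
  have hrr : r * r = step T N := Real.mul_self_sqrt hstep.le
  have hXi := integrable_realizedVol fun j hj => hX.memLp_increment he (N := N) (j := j) hj
  have hMi := integrable_realizedVol fun j hj => hM.memLp_increment (N := N) (j := j) hj
  have hAi : Integrable (fun ω => ∑ j ∈ Finset.range N, driftIncrement T N μ j ω ^ 2) P :=
    integrable_finsetSum _ fun j hj =>
      (memLp_driftIncrement hX.drift_progressive he (Finset.mem_range.1 hj)).integrable_sq
  have hA := integral_sum_driftIncrement_sq_le hX.drift_progressive he hN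
  have hall : ∀ᵐ ω ∂P, ∀ j ∈ Finset.range N, samples T N X ω (j + 1) - samples T N X ω j =
      driftIncrement T N μ j ω + (samples T N M ω (j + 1) - samples T N M ω j) :=
    (Finset.eventually_all _).2 fun j hj => hX.ae_increment_eq (Finset.mem_range.1 hj)
  -- The weight `r = √Δt` balances the two terms: the `a ^ 2` total to order `r ^ 2` and are
  -- multiplied by `r⁻¹`, the `m ^ 2` total to order 1 and are multiplied by `r`.
  have hpt : ∀ a m : ℝ, |(a + m) ^ 2 - m ^ 2| ≤ (1 + r⁻¹) * a ^ 2 + r * m ^ 2 := by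
    intro a m
    have h1 : 0 ≤ r⁻¹ * (a - r * m) ^ 2 := by positivity
    have h2 : 0 ≤ r⁻¹ * (a + r * m) ^ 2 := by positivity
    have e1 : r⁻¹ * (a - r * m) ^ 2 = r⁻¹ * a ^ 2 - 2 * a * m + r * m ^ 2 := by field_simp; ring
    have e2 : r⁻¹ * (a + r * m) ^ 2 = r⁻¹ * a ^ 2 + 2 * a * m + r * m ^ 2 := by field_simp; ring
    rw [abs_le]
    constructor <;> nlinarith [sq_nonneg a]
  rw [← integral_sub hXi hMi]
  calc |∫ ω, (realizedVol N (samples T N X ω) - realizedVol N (samples T N M ω)) ∂P|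
      ≤ ∫ ω, |realizedVol N (samples T N X ω) - realizedVol N (samples T N M ω)| ∂P :=
        abs_integral_le_integral_abs
    _ ≤ ∫ ω, ((1 + r⁻¹) * ∑ j ∈ Finset.range N, driftIncrement T N μ j ω ^ 2 +
          r * realizedVol N (samples T N M ω)) ∂P := by
        refine integral_mono_ae (hXi.sub hMi).abs ((hAi.const_mul _).add (hMi.const_mul _)) ?_
        filter_upwards [hall] with ω hω
        unfold realizedVol
        rw [← Finset.sum_sub_distrib, Finset.mul_sum, Finset.mul_sum, ← Finset.sum_add_distrib]
        refine (Finset.abs_sum_le_sum_abs _ _).trans (Finset.sum_le_sum fun j hj => ?_)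
        rw [hω j hj]
        exact hpt _ _
    _ = (1 + r⁻¹) * (∫ ω, ∑ j ∈ Finset.range N, driftIncrement T N μ j ω ^ 2 ∂P) +
          r * ∫ ω, (M T ω - M 0 ω) ^ 2 ∂P := by
        rw [integral_add (hAi.const_mul _) (hMi.const_mul _), integral_const_mul,
          integral_const_mul, hM.integral_realizedVol hX.brownian hN]
    _ ≤ (1 + r⁻¹) * (step T N * C) + r * ∫ ω, (M T ω - M 0 ω) ^ 2 ∂P := by gcongr
    _ = _ := by
        rw [← hrr]
        field_simp
        ring

theorem IsWhiteNoise.integral_increment_sq {N : ℕ} {σε : ℝ} {ε : ℕ → Ω → ℝ}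
    (hε : IsWhiteNoise P N σε ε) {j : ℕ} (hj : j < N) :
    ∫ ω, (ε (j + 1) ω - ε j ω) ^ 2 ∂P = 2 * σε ^ 2 := by
  have h1 := hε.memLp (j + 1) hj
  have h0 := hε.memLp j hj.le
  have hm : Integrable (fun ω => ε (j + 1) ω * ε j ω) P := h1.integrable_mul h0
  have he : ∀ ω, (ε (j + 1) ω - ε j ω) ^ 2 =
      ε (j + 1) ω ^ 2 - 2 * (ε (j + 1) ω * ε j ω) + ε j ω ^ 2 := fun ω => by ring
  simp only [he]
  rw [integral_add (f := fun ω => ε (j + 1) ω ^ 2 - 2 * (ε (j + 1) ω * ε j ω))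
    (h1.integrable_sq.sub (hm.const_mul 2)) h0.integrable_sq,
    integral_sub h1.integrable_sq (hm.const_mul 2), integral_const_mul,
    hε.variance _ hj, hε.variance _ hj.le, hε.uncorrelated _ hj _ hj.le (by omega)]
  ring

theorem IsWhiteNoise.memLp_increment {N : ℕ} {σε : ℝ} {ε : ℕ → Ω → ℝ}
    (hε : IsWhiteNoise P N σε ε) {j : ℕ} (hj : j < N) :
    MemLp (fun ω => ε (j + 1) ω - ε j ω) 2 P :=
  (hε.memLp _ hj).sub (hε.memLp _ hj.le)

theorem observed_increment (N : ℕ) (ε : ℕ → Ω → ℝ) (ω : Ω) (j : ℕ) :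
    observed T N X ε ω (j + 1) - observed T N X ε ω j =
      (samples T N X ω (j + 1) - samples T N X ω j) + (ε (j + 1) ω - ε j ω) := by
  unfold observed; ring

theorem memLp_observed_increment {N : ℕ} {σε : ℝ} {ε : ℕ → Ω → ℝ}
    (hX : IsItoProcess 𝓕 P B T μ σ M X) (he : energy P T μ < ∞) (hε : IsWhiteNoise P N σε ε)
    {j : ℕ} (hj : j < N) :
    MemLp (fun ω => observed T N X ε ω (j + 1) - observed T N X ε ω j) 2 P := by
  simp only [observed_increment]
  exact (hX.memLp_increment he hj).add (hε.memLp_increment hj)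

/-- Independent white noise adds `2 σ_ε²` per increment to the expected realized volatility. -/
theorem integral_realizedVol_observed {N : ℕ} {σε : ℝ} {ε : ℕ → Ω → ℝ}
    [IsProbabilityMeasure P] (hX : IsItoProcess 𝓕 P B T μ σ M X) (he : energy P T μ < ∞)
    (hε : IsWhiteNoise P N σε ε)
    (hind : IndepFun (fun ω (j : Fin (N + 1)) => ε j ω)
      (fun ω (j : Fin (N + 1)) => samples T N X ω j) P) :
    ∫ ω, realizedVol N (observed T N X ε ω) ∂P =
      ∫ ω, realizedVol N (samples T N X ω) ∂P + 2 * N * σε ^ 2 := by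
  unfold realizedVol
  rw [integral_finsetSum _ fun j hj =>
      (memLp_observed_increment hX he hε (Finset.mem_range.1 hj)).integrable_sq,
    integral_finsetSum _ fun j hj =>
      (hX.memLp_increment he (Finset.mem_range.1 hj)).integrable_sq]
  have key : ∀ j ∈ Finset.range N,
      ∫ ω, (observed T N X ε ω (j + 1) - observed T N X ε ω j) ^ 2 ∂P =
        ∫ ω, (samples T N X ω (j + 1) - samples T N X ω j) ^ 2 ∂P + 2 * σε ^ 2 := by
    intro j hj
    have hj := Finset.mem_range.1 hj
    have hx := hX.memLp_increment he hj
    have hn := hε.memLp_increment hj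
    -- The same map extracts the `j`-th increment from both sample vectors, so their joint
    -- independence passes to the increments.
    have hφ : Measurable fun v : Fin (N + 1) → ℝ =>
        v ⟨j + 1, by omega⟩ - v ⟨j, by omega⟩ := by fun_prop
    have hi : IndepFun (fun ω => ε (j + 1) ω - ε j ω)
      (fun ω => samples T N X ω (j + 1) - samples T N X ω j) P := hind.comp hφ hφ
    have hcross : ∫ ω, (ε (j + 1) ω - ε j ω) *
        (samples T N X ω (j + 1) - samples T N X ω j) ∂P = 0 := by
      rw [hi.integral_fun_mul_eq_mul_integral hn.aestronglyMeasurable hx.aestronglyMeasurable,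
        integral_sub ((hε.memLp _ hj).integrable (by norm_num))
          ((hε.memLp _ hj.le).integrable (by norm_num)),
        hε.mean_zero _ hj, hε.mean_zero _ hj.le]
      simp
    have hm : Integrable (fun ω => (ε (j + 1) ω - ε j ω) *
        (samples T N X ω (j + 1) - samples T N X ω j)) P := hn.integrable_mul hx
    have hexp : ∀ ω, (observed T N X ε ω (j + 1) - observed T N X ε ω j) ^ 2 =
        (samples T N X ω (j + 1) - samples T N X ω j) ^ 2 +
          2 * ((ε (j + 1) ω - ε j ω) * (samples T N X ω (j + 1) - samples T N X ω j)) +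
          (ε (j + 1) ω - ε j ω) ^ 2 := fun ω => by rw [observed_increment]; ring
    simp only [hexp]
    rw [integral_add (f := fun ω => (samples T N X ω (j + 1) - samples T N X ω j) ^ 2 +
        2 * ((ε (j + 1) ω - ε j ω) * (samples T N X ω (j + 1) - samples T N X ω j)))
      (hx.integrable_sq.add (hm.const_mul 2)) hn.integrable_sq,
      integral_add hx.integrable_sq (hm.const_mul 2), integral_const_mul, hcross,
      hε.integral_increment_sq hj]
    ring
  rw [Finset.sum_congr rfl key, Finset.sum_add_distrib]
  simp
  ring

theorem integrable_norm_dft_sq {N : ℕ} (hM : IsItoIntegral 𝓕 P B T σ M) (hT : 0 < T)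
    (k : ℕ) :
    Integrable (fun ω => ‖dft T N (samples T N M ω) k‖ ^ 2) P := by
  have h : MemLp (fun ω => dft T N (samples T N M ω) k) 2 P := by
    have hj : ∀ j ∈ Finset.range N, MemLp (fun ω =>
        ((samples T N M ω (j + 1) - samples T N M ω j : ℝ) : ℂ) *
          (Complex.exp (2 * Real.pi * Complex.I / N))⁻¹ ^ (j * k)) 2 P := fun j hj => by
      have h : MemLp (fun ω => ((samples T N M ω (j + 1) - samples T N M ω j : ℝ) : ℂ)) 2 P :=
        (hM.memLp_increment (Finset.mem_range.1 hj)).ofReal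
      exact h.mul_const _
    simp only [dft_eq hT]
    exact (memLp_finsetSum _ hj).const_mul _
  exact h.integrable_norm_pow (by norm_num)

theorem sum_spectrum {N : ℕ} (hM : IsItoIntegral 𝓕 P B T σ M) (hT : 0 < T) (hN : 1 ≤ N) :
    ∑ k ∈ Finset.range N, spectrum P T N M k = ∫ ω, realizedVol N (samples T N M ω) ∂P := by
  simp only [realizedVol_eq_sum_norm_dft_sq hT hN, spectrum]
  rw [integral_finsetSum _ fun k _ => integrable_norm_dft_sq hM hT k]

end Observation

/-! ### Asymptotics as `Δt → 0` -/

theorem tendsto_step {T : ℝ≥0} (hT : 0 < T) : Tendsto (step T) atTop (𝓝[>] 0) := by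
  have hT' : (0 : ℝ) < T := by exact_mod_cast hT
  refine tendsto_nhdsWithin_iff.2 ⟨tendsto_const_div_atTop_nhds_zero_nat _, ?_⟩
  filter_upwards [eventually_ge_atTop 1] with N hN
  unfold step
  exact Set.mem_Ioi.2 (by positivity)

/-- Since `log Δt → -∞`, its absolute value is eventually at least 1. -/
theorem isBigO_sqrt_step {T : ℝ≥0} (hT : 0 < T) :
    (fun N => √(step T N)) =O[atTop] fun N => Real.log (step T N) * √(step T N) := by
  have h := Real.tendsto_log_nhdsGT_zero.comp (tendsto_step hT)
  refine IsBigO.of_bound 1 ?_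
  filter_upwards [h.eventually (eventually_le_atBot (-1))] with N hN
  simp only [Function.comp] at hN
  rw [one_mul, norm_mul]
  refine le_mul_of_one_le_left (norm_nonneg _) ?_
  rw [Real.norm_eq_abs, abs_of_nonpos (by linarith)]
  linarith

theorem isBigO_step_add_sqrt_step {T : ℝ≥0} (hT : 0 < T) (C K : ℝ) :
    (fun N => step T N * C + √(step T N) * K) =O[atTop]
      fun N => Real.log (step T N) * √(step T N) := by
  have h1 : (step T) =O[atTop] fun N => √(step T N) := by
    refine IsBigO.of_bound 1 ?_
    have h := (tendsto_step hT).mono_right nhdsWithin_le_nhds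
    filter_upwards [(tendsto_step hT).eventually self_mem_nhdsWithin,
      h.eventually_le_const one_pos] with N h0 h1
    have h0' : 0 ≤ step T N := le_of_lt h0
    rw [one_mul, Real.norm_of_nonneg h0', Real.norm_of_nonneg (Real.sqrt_nonneg _)]
    exact Real.le_sqrt_of_sq_le (by nlinarith)
  have := ((h1.const_mul_left C).add ((isBigO_refl _ _).const_mul_left K)).trans
    (isBigO_sqrt_step hT)
  simpa only [mul_comm] using this

theorem eventually_sum_noiseSpectrum {T : ℝ≥0} (hT : 0 < T) (σε : ℝ) :
    (fun N => ∑ k ∈ Finset.range N, noiseSpectrum T N σε k) =ᶠ[atTop]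
      fun N => (2 * σε ^ 2 * T) * (step T N)⁻¹ := by
  have hT' : (T : ℝ) ≠ 0 := by exact_mod_cast hT.ne'
  filter_upwards [eventually_ge_atTop 2] with N hN
  rw [sum_noiseSpectrum hT hN, step]
  field_simp

end NoisyIto

/-! ### Assembly of the estimates -/

theorem lemma1 {Ω : Type*} {mΩ : MeasurableSpace Ω} (P : Measure Ω) [IsProbabilityMeasure P]
    (𝓕 : Filtration ℝ≥0 mΩ) (T : ℝ≥0) (hT : 0 < T)
    (B μ σ M X : ℝ≥0 → Ω → ℝ)
    (hX : NoisyIto.IsItoProcess 𝓕 P B T μ σ M X)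
    (hμ : NoisyIto.energy P T μ < ∞)
    (σε : ℝ) (ε : ℕ → ℕ → Ω → ℝ)
    (hε : ∀ N, 1 ≤ N → NoisyIto.IsWhiteNoise P N σε (ε N))
    (hind : ∀ N, 1 ≤ N →
      IndepFun (fun ω (j : Fin (N + 1)) => ε N j ω)
        (fun ω (j : Fin (N + 1)) => NoisyIto.samples T N X ω j) P) :
    -- all the expectations below are those of integrable random variables
    (∀ N, 1 ≤ N →
      Integrable (fun ω => NoisyIto.realizedVol N (NoisyIto.observed T N X (ε N) ω)) P ∧
      Integrable (fun ω => NoisyIto.realizedVol N (NoisyIto.samples T N X ω)) P ∧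
      ∀ k < N, Integrable
        (fun ω => ‖NoisyIto.dft T N (NoisyIto.samples T N M ω) k‖ ^ 2) P) ∧
    -- the naive estimator in the time domain and in the frequency domain
    (∀ N, 1 ≤ N → ∀ ω, NoisyIto.realizedVol N (NoisyIto.observed T N X (ε N) ω) =
      ∑ k ∈ Finset.range N, ‖NoisyIto.dft T N (NoisyIto.observed T N X (ε N) ω) k‖ ^ 2) ∧
    -- the expectation of the naive estimator, frequency by frequency
    (fun N : ℕ => (∫ ω, NoisyIto.realizedVol N (NoisyIto.observed T N X (ε N) ω) ∂P) -
        ∑ k ∈ Finset.range N,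
          (NoisyIto.spectrum P T N M k + NoisyIto.noiseSpectrum T N σε k))
      =O[atTop] (fun N : ℕ =>
        Real.log (NoisyIto.step T N) * Real.sqrt (NoisyIto.step T N)) ∧
    -- the same, relative to the expected noise-free realized volatility
    (fun N : ℕ => (∫ ω, NoisyIto.realizedVol N (NoisyIto.observed T N X (ε N) ω) ∂P) -
        ((∫ ω, NoisyIto.realizedVol N (NoisyIto.samples T N X ω) ∂P) +
          ∑ k ∈ Finset.range N, NoisyIto.noiseSpectrum T N σε k))
      =O[atTop] (fun N : ℕ =>
        Real.log (NoisyIto.step T N) * Real.sqrt (NoisyIto.step T N)) ∧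
    -- the orders of the two leading terms
    (fun N : ℕ => ∫ ω, NoisyIto.realizedVol N (NoisyIto.samples T N X ω) ∂P)
      =O[atTop] (fun _ : ℕ => (1 : ℝ)) ∧
    (fun N : ℕ => ∑ k ∈ Finset.range N, NoisyIto.noiseSpectrum T N σε k)
      =O[atTop] (fun N : ℕ => (NoisyIto.step T N)⁻¹) ∧
    (σε ≠ 0 → (fun N : ℕ => ∑ k ∈ Finset.range N, NoisyIto.noiseSpectrum T N σε k)
      =Θ[atTop] (fun N : ℕ => (NoisyIto.step T N)⁻¹)) := by
  have hM := hX.martingale_part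
  have hE : ∀ N, 2 ≤ N → ∫ ω, NoisyIto.realizedVol N (NoisyIto.observed T N X (ε N) ω) ∂P =
      ∫ ω, NoisyIto.realizedVol N (NoisyIto.samples T N X ω) ∂P +
        ∑ k ∈ Finset.range N, NoisyIto.noiseSpectrum T N σε k := fun N hN => by
    rw [NoisyIto.sum_noiseSpectrum hT hN]
    exact NoisyIto.integral_realizedVol_observed hX hμ (hε N (by omega)) (hind N (by omega))
  have hbias : (fun N : ℕ => ∫ ω, NoisyIto.realizedVol N (NoisyIto.samples T N X ω) ∂P -
      ∫ ω, NoisyIto.realizedVol N (NoisyIto.samples T N M ω) ∂P) =O[atTop]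
      fun N : ℕ => Real.log (NoisyIto.step T N) * Real.sqrt (NoisyIto.step T N) := by
    refine IsBigO.trans (IsBigO.of_bound 1 ?_) (NoisyIto.isBigO_step_add_sqrt_step hT
      (NoisyIto.energy P T μ).toReal ((NoisyIto.energy P T μ).toReal +
        ∫ ω, (M T ω - M 0 ω) ^ 2 ∂P))
    filter_upwards [eventually_ge_atTop 1] with N hN
    rw [one_mul, Real.norm_eq_abs]
    exact (hX.abs_integral_realizedVol_sub_le hμ hN hT).trans (le_abs_self _)
  have hnoise := NoisyIto.eventually_sum_noiseSpectrum hT σε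
  refine ⟨fun N hN => ⟨?_, ?_, fun k _ => NoisyIto.integrable_norm_dft_sq hM hT k⟩,
    fun N hN ω => NoisyIto.realizedVol_eq_sum_norm_dft_sq hT hN _, ?_, ?_, ?_, ?_, fun hσ => ?_⟩
  · exact NoisyIto.integrable_realizedVol fun j hj =>
      NoisyIto.memLp_observed_increment hX hμ (hε N hN) hj
  · exact NoisyIto.integrable_realizedVol fun j hj => hX.memLp_increment hμ hj
  · refine hbias.congr' ?_ .rfl
    filter_upwards [eventually_ge_atTop 2] with N hN
    rw [hE N hN, Finset.sum_add_distrib, NoisyIto.sum_spectrum hM hT (by omega)]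
    ring
  -- The difference is identically zero from `N = 2` on.
  · refine (isBigO_zero _ _).congr' ?_ .rfl
    filter_upwards [eventually_ge_atTop 2] with N hN
    rw [hE N hN, sub_self]
  -- Boundedness: the drift correction tends to 0 and the martingale contribution is constant in
  -- `N`.
  · have hzero : Tendsto (fun N : ℕ => NoisyIto.step T N * (NoisyIto.energy P T μ).toReal +
        Real.sqrt (NoisyIto.step T N) * ((NoisyIto.energy P T μ).toReal +
          ∫ ω, (M T ω - M 0 ω) ^ 2 ∂P)) atTop (𝓝 0) := by
      have h := (NoisyIto.tendsto_step hT).mono_right nhdsWithin_le_nhds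
      simpa using (h.mul_const (NoisyIto.energy P T μ).toReal).add (h.sqrt.mul_const
        ((NoisyIto.energy P T μ).toReal + ∫ ω, (M T ω - M 0 ω) ^ 2 ∂P))
    have hdiff : (fun N : ℕ => ∫ ω, NoisyIto.realizedVol N (NoisyIto.samples T N X ω) ∂P -
        ∫ ω, NoisyIto.realizedVol N (NoisyIto.samples T N M ω) ∂P) =O[atTop]
        fun _ : ℕ => (1 : ℝ) := by
      refine IsBigO.trans (IsBigO.of_bound 1 ?_) (hzero.isBigO_one ℝ)
      filter_upwards [eventually_ge_atTop 1] with N hN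
      rw [one_mul, Real.norm_eq_abs]
      exact (hX.abs_integral_realizedVol_sub_le hμ hN hT).trans (le_abs_self _)
    refine (hdiff.add (isBigO_const_const (∫ ω, (M T ω - M 0 ω) ^ 2 ∂P) one_ne_zero _)).congr'
      ?_ .rfl
    filter_upwards [eventually_ge_atTop 1] with N hN
    rw [hM.integral_realizedVol hX.brownian hN]
    ring
  · exact ((isBigO_refl _ _).const_mul_left _).congr' hnoise.symm .rfl
  · refine hnoise.isTheta.trans ?_
    have hT' : (T : ℝ) ≠ 0 := by exact_mod_cast hT.ne'
    exact (isTheta_const_mul_left (by positivity)).2 (isTheta_refl _ _)
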